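/- Let $p, q, r$ be integers with $pq \neq 0$. Then the equation $$x^{2+ip} + y^{2+iq} = z^{2+ir}$$ has no solution in positive integers $x, y, z$ with $\gcd(x,y,z) = 1$. Here $i$ is the imaginary unit, and for a positive integer $n$ and a complex number $s$ the power is $n^{s} = e^{s \log n}$ with $\log n$ the real logarithm. -/

import Mathlib

/-! Since `|n ^ (2 + ip)| = n ^ 2`, a solution gives a triangle with side lengths `x², y², z²`, so
`cos t` is rational for `t = p log x - q log y`. Thus `e^{it}` is algebraic, while `e^t = x^p / y^q`
is rational. Gelfond–Schneider with exponent `i` (`eq_zero_of_isAlgebraic_exp`) forces `t = 0`: the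
triangle degenerates to `x² + y² = z²`, and `x^|p| = y^|q|` gives `x` and `y` the same prime
factors, against coprimality.

Gelfond–Schneider is proved by Schneider's method in `false_of_exp_mem_numberField`. Siegel's lemma
supplies `F(z) = ∑ c_{jk} z^j e^{tkz}`, not identically zero, vanishing on a box of Gaussian
integers. Zeros on a `T × T` box make `F` tiny on the next box by Schwarz, whereas its values there,
cleared of denominators, are algebraic integers with bounded conjugates. The norm inequality makes
them zero, so the zeros spread to all of `ℕ + ℕi`; growth along `ℕ` then kills every coefficient. -/

/-! ### Linear independence of exponential monomials on `ℕ`. -/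

open Filter Topology in
/-- A nonzero polynomial does not tend to zero along the natural numbers. -/
theorem Polynomial.eq_zero_of_tendsto_eval_natCast {P : Polynomial ℂ}
    (h : Tendsto (fun n : ℕ => P.eval (n : ℂ)) atTop (𝓝 0)) : P = 0 := by
  by_cases hP : 0 < P.degree
  · have hn : Tendsto (fun n : ℕ => ‖(n : ℂ)‖) atTop atTop := by
      simpa using tendsto_natCast_atTop_atTop (R := ℝ)
    have h1 := P.tendsto_norm_atTop hP hn
    have h2 := h.norm
    exact absurd h2 (not_tendsto_nhds_of_tendsto_atTop h1 _)
  · rw [Polynomial.eq_C_of_degree_le_zero (not_lt.mp hP)] at h ⊢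
    simp only [Polynomial.eval_C, tendsto_const_nhds_iff] at h
    simp [h]

open Filter Topology in
theorem Polynomial.tendsto_eval_natCast_mul_pow (P : Polynomial ℂ) {x : ℝ} (h0 : 0 ≤ x)
    (h1 : x < 1) : Tendsto (fun n : ℕ => P.eval (n : ℂ) * (x : ℂ) ^ n) atTop (𝓝 0) := by
  have key : ∀ j : ℕ, Tendsto (fun n : ℕ => (n : ℂ) ^ j * (x : ℂ) ^ n) atTop (𝓝 0) := by
    intro j
    have := tendsto_pow_const_mul_const_pow_of_abs_lt_one j (r := x) (by rwa [abs_of_nonneg h0])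
    have := (Complex.continuous_ofReal.tendsto 0).comp this
    simpa [Function.comp_def] using this
  simp only [Polynomial.eval_eq_sum_range, Finset.sum_mul]
  rw [← Finset.sum_const_zero (s := Finset.range (P.natDegree + 1))]
  refine tendsto_finsetSum _ fun j _ => ?_
  simpa [mul_assoc] using (key j).const_mul (P.coeff j)

open Filter Topology in
/-- For `1 < x` the functions `n ↦ n ^ j * x ^ (k * n)` on `ℕ` are linearly independent. -/
theorem polynomial_eq_zero_of_sum_eval_mul_pow_eq_zero {x : ℝ} (hx : 1 < x) (N : ℕ)
    (P : ℕ → Polynomial ℂ)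
    (h : ∀ n : ℕ, ∑ k ∈ Finset.range N, (P k).eval (n : ℂ) * (x : ℂ) ^ (k * n) = 0) :
    ∀ k < N, P k = 0 := by
  induction N with
  | zero => intro k hk; omega
  | succ N ih =>
    have hx0 : (x : ℂ) ≠ 0 := by
      exact_mod_cast (by linarith : x ≠ 0)
    have hN : P N = 0 := by
      -- Divided by `x ^ (N * n)`, the relation expresses `P N` through terms decaying geometrically
      -- in `n`.
      apply Polynomial.eq_zero_of_tendsto_eval_natCast
      have heq : ∀ n : ℕ, (P N).eval (n : ℂ) =
          ∑ k ∈ Finset.range N, -((P k).eval (n : ℂ) * (((x⁻¹) ^ (N - k) : ℝ) : ℂ) ^ n) := by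
        intro n
        have h1 := h n
        rw [Finset.sum_range_succ] at h1
        have h2 : (x : ℂ) ^ (N * n) ≠ 0 := pow_ne_zero _ hx0
        apply mul_right_cancel₀ h2
        rw [← add_right_inj, h1, Finset.sum_mul, ← Finset.sum_add_distrib, eq_comm]
        apply Finset.sum_eq_zero
        intro k hk
        have hk := Finset.mem_range.mp hk
        obtain ⟨e, rfl⟩ := Nat.exists_eq_add_of_lt hk
        have : k + e + 1 - k = e + 1 := by omega
        rw [this]
        push_cast
        rw [show (k + e + 1) * n = k * n + (e + 1) * n by ring,
          pow_add (x : ℂ) (k * n), inv_pow, inv_pow, ← pow_mul]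
        field_simp
        ring
      simp only [heq]
      rw [← Finset.sum_const_zero (s := Finset.range N)]
      refine tendsto_finsetSum _ fun k hk => ?_
      have hk := Finset.mem_range.mp hk
      have := (P k).tendsto_eval_natCast_mul_pow (x := (x⁻¹) ^ (N - k)) (by positivity)
        (pow_lt_one₀ (by positivity) (inv_lt_one_of_one_lt₀ hx) (by omega))
      simpa using this.neg
    intro k hk
    rcases Nat.lt_succ_iff_lt_or_eq.mp hk with hk | rfl
    · refine ih (fun n => ?_) k hk
      have := h n
      rw [Finset.sum_range_succ, hN] at this
      simpa using this
    · exact hN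

theorem coeff_eq_zero_of_sum_mul_pow_mul_exp_eq_zero {t : ℝ} (ht : 0 < t) {M N : ℕ}
    (c : Fin M × Fin N → ℂ)
    (h : ∀ n : ℕ, ∑ l, c l * (n : ℂ) ^ (l.1 : ℕ) * Complex.exp (t * (l.2 : ℕ) * n) = 0) :
    c = 0 := by
  set P : ℕ → Polynomial ℂ := fun k =>
    if hk : k < N then ∑ j : Fin M, Polynomial.monomial (j : ℕ) (c (j, ⟨k, hk⟩)) else 0 with hP
  have hx : 1 < Real.exp t := Real.one_lt_exp_iff.mpr ht
  have key := polynomial_eq_zero_of_sum_eval_mul_pow_eq_zero hx N P (by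
    intro n
    rw [← h n, Finset.sum_range, Fintype.sum_prod_type_right]
    refine Finset.sum_congr rfl fun k _ => ?_
    simp only [hP, k.2, dif_pos, Polynomial.eval_finsetSum, Polynomial.eval_monomial,
      Finset.sum_mul, Fin.eta, Complex.ofReal_exp]
    refine Finset.sum_congr rfl fun j _ => ?_
    rw [← Complex.exp_nat_mul]
    push_cast
    ring_nf)
  ext ⟨j, k⟩
  have h1 := congrArg (fun Q => Polynomial.coeff Q (j : ℕ)) (key k k.2)
  simpa [hP, Polynomial.finsetSum_coeff, Polynomial.coeff_monomial, Fin.val_inj] using h1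

/-! ### Schwarz lemma for many zeros. -/

/-- An entire function vanishing on a finite set is divisible by the corresponding polynomial. -/
theorem Differentiable.exists_eq_prod_sub_mul {f : ℂ → ℂ} (hf : Differentiable ℂ f)
    (Z : Finset ℂ) (hZ : ∀ ζ ∈ Z, f ζ = 0) :
    ∃ g : ℂ → ℂ, Differentiable ℂ g ∧ ∀ z, f z = (∏ ζ ∈ Z, (z - ζ)) * g z := by
  classical
  induction Z using Finset.induction_on with
  | empty => exact ⟨f, hf, by simp⟩
  | insert a Z ha ih =>
    obtain ⟨g, hg, hfg⟩ := ih fun ζ hζ => hZ ζ (Finset.mem_insert_of_mem hζ)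
    have hga : g a = 0 := by
      have h1 := hZ a (Finset.mem_insert_self _ _)
      rw [hfg] at h1
      refine (mul_eq_zero.mp h1).resolve_left ?_
      refine Finset.prod_ne_zero_iff.mpr fun ζ hζ h2 => ?_
      rw [sub_eq_zero] at h2
      exact ha (h2 ▸ hζ)
    refine ⟨dslope g a, ?_, fun z => ?_⟩
    · rw [← differentiableOn_univ] at hg ⊢
      exact (Complex.differentiableOn_dslope Filter.univ_mem).mpr hg
    · have h1 := sub_smul_dslope g a z
      rw [hga, sub_zero, smul_eq_mul] at h1
      rw [Finset.prod_insert ha, hfg, ← h1]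
      ring

/-- A Schwarz lemma for entire functions with many zeros. -/
theorem Differentiable.norm_le_mul_pow_card_of_zeros {f : ℂ → ℂ} (hf : Differentiable ℂ f)
    (Z : Finset ℂ) (hZ : ∀ ζ ∈ Z, f ζ = 0) {r R M : ℝ} (hr : ∀ ζ ∈ Z, ‖ζ‖ ≤ r) (h0 : 0 ≤ r)
    (hR : r < R) (hM : ∀ z, ‖z‖ = R → ‖f z‖ ≤ M) {w : ℂ} (hw : ‖w‖ ≤ r) :
    ‖f w‖ ≤ M * (2 * r / (R - r)) ^ Z.card := by
  obtain ⟨g, hg, hfg⟩ := hf.exists_eq_prod_sub_mul Z hZ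
  have hRr : 0 < R - r := by linarith
  have hRpos : 0 < R := by linarith
  -- Maximum principle for the quotient: on `‖z‖ = R` every factor `z - ζ` has norm at least `R -
  -- r`.
  have hg' : ‖g w‖ ≤ M / (R - r) ^ Z.card := by
    refine Complex.norm_le_of_forall_mem_frontier_norm_le (U := Metric.ball 0 R)
      Metric.isBounded_ball hg.diffContOnCl (fun z hz => ?_) (subset_closure ?_)
    · rw [frontier_ball _ hRpos.ne', mem_sphere_zero_iff_norm] at hz
      rw [le_div_iff₀ (by positivity), mul_comm]
      refine le_trans ?_ (hM z hz)
      rw [hfg, norm_mul, norm_prod]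
      gcongr
      rw [← Finset.prod_const]
      refine Finset.prod_le_prod (fun _ _ => hRr.le) fun ζ hζ => ?_
      have := norm_sub_norm_le z ζ
      have := hr ζ hζ
      linarith
    · rw [mem_ball_zero_iff]; linarith
  have hM0 : 0 ≤ M := by
    refine (norm_nonneg _).trans (hM (R : ℂ) ?_)
    rw [Complex.norm_real, Real.norm_of_nonneg hRpos.le]
  calc ‖f w‖ = (∏ ζ ∈ Z, ‖w - ζ‖) * ‖g w‖ := by rw [hfg, norm_mul, norm_prod]
    _ ≤ (2 * r) ^ Z.card * (M / (R - r) ^ Z.card) := by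
        gcongr
        rw [← Finset.prod_const]
        refine Finset.prod_le_prod (fun _ _ => norm_nonneg _) fun ζ hζ => ?_
        have := norm_sub_le w ζ
        have := hr ζ hζ
        linarith
    _ = _ := by rw [div_pow]; ring

/-! ### Siegel's lemma and the norm inequality. -/

open NumberField


/-- With twice as many unknowns as equations the Siegel exponent `q / (2q - q)` is `1`, so the bound
is linear in `A`. -/
theorem NumberField.exists_int_vec_house_le (K : Type*) [Field K] [NumberField K] :
    ∃ c : ℝ, 1 ≤ c ∧ ∀ {α β : Type} [Fintype α] [Fintype β] (a : Matrix α β (𝓞 K)) (A : ℝ) (q : ℕ),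
      0 < q → Fintype.card α = q → Fintype.card β = 2 * q → a ≠ 0 →
      (∀ k l, house (algebraMap (𝓞 K) K (a k l)) ≤ A) →
      ∃ ξ : β → 𝓞 K, ξ ≠ 0 ∧ a.mulVec ξ = 0 ∧
        ∀ l, house (algebraMap (𝓞 K) K (ξ l)) ≤ c * (2 * q) * A := by
  classical
  have key : ∃ c : ℝ, ∀ {α β : Type} [Fintype α] [Fintype β] (a : Matrix α β (𝓞 K)) (A : ℝ)
      (q : ℕ), 0 < q → Fintype.card α = q → Fintype.card β = 2 * q → a ≠ 0 →
      (∀ k l, house (algebraMap (𝓞 K) K (a k l)) ≤ A) →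
      ∃ ξ : β → 𝓞 K, ξ ≠ 0 ∧ a.mulVec ξ = 0 ∧
        ∀ l, house (algebraMap (𝓞 K) K (ξ l)) ≤
          c * ((c * (2 * q : ℕ) * A) ^ ((q : ℝ) / ((2 * q : ℕ) - q))) :=
    ⟨_, fun a A q hq hα hβ ha hA =>
      house.exists_ne_zero_int_vec_house_le K a ha hq (by omega) hβ hA hα⟩
  obtain ⟨c, hc⟩ := key
  refine ⟨c ^ 2 + 1, by nlinarith, fun a A q hq hα hβ ha hA => ?_⟩
  obtain ⟨ξ, h1, h2, h3⟩ := hc a A q hq hα hβ ha hA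
  refine ⟨ξ, h1, h2, fun l => (h3 l).trans ?_⟩
  have hq' : (q : ℝ) ≠ 0 := by positivity
  have : (q : ℝ) / ((2 * q : ℕ) - q) = 1 := by
    push_cast; rw [two_mul, add_sub_cancel_right, div_self hq']
  rw [this, Real.rpow_one]
  have hA0 : 0 ≤ A := by
    have : Nonempty _ := Fintype.card_pos_iff.mp (hα ▸ hq)
    have : Nonempty _ := Fintype.card_pos_iff.mp (hβ ▸ (by omega : 0 < 2 * q))
    exact (house_nonneg _).trans (hA (Classical.arbitrary _) (Classical.arbitrary _))
  push_cast
  have : 0 ≤ 2 * (q : ℝ) * A := by positivity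
  linarith

theorem NumberField.house_le_of_forall {K : Type*} [Field K] [NumberField K] {x : K} {B : ℝ}
    (hB : 0 ≤ B) (h : ∀ τ : K →+* ℂ, ‖τ x‖ ≤ B) : house x ≤ B :=
  (pi_norm_le_iff_of_nonneg hB).mpr h

/-- The norm of a nonzero algebraic integer is a nonzero rational integer, and the house bounds all
the other conjugates. -/
theorem NumberField.one_le_norm_mul_house_pow {K : Type*} [Field K] [NumberField K]
    (σ : K →+* ℂ) {x : 𝓞 K} (hx : x ≠ 0) :
    1 ≤ ‖σ x‖ * house (x : K) ^ (Module.finrank ℚ K - 1) := by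
  refine le_trans ?_ (norm_norm_le_norm_mul_house_pow (x : K) σ)
  have h1 : Algebra.norm ℤ x ≠ 0 := Algebra.norm_ne_zero_iff.mpr hx
  rw [← Algebra.coe_norm_int]
  have : (1 : ℤ) ≤ |Algebra.norm ℤ x| := Int.one_le_abs h1
  rw [Int.norm_cast_rat, Int.norm_eq_abs]
  exact_mod_cast this

/-! ### Choice of parameters. -/

open Filter Topology in
-- The left side is what the Liouville argument must beat. Taking `2 ^ m > C ^ (4 * D + 1)` bounds
-- the powers of `C` by `2 ^ (T * m * N) ≤ 2 ^ (T ^ 2)`. The rest is at most `Q ^ (T * D)` with `Q`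
-- polynomial in `T`, which `(3 / 2) ^ (T ^ 2)` exceeds once `N`, hence `T`, is large.
theorem exists_schneider_parameters (c C : ℝ) (hc : 1 ≤ c) (hC : 1 ≤ C) (D : ℕ) :
    ∃ m N : ℕ, 0 < m ∧ 0 < N ∧ ∀ T : ℕ, m * N ≤ T →
      C ^ (T * N) * (c * (2 * (T : ℝ) ^ 2) ^ 2 * (14 * (T : ℝ)) ^ (2 * (2 * m ^ 2 * N)) *
        C ^ (4 * (T * N))) ^ D < 3 ^ (T ^ 2) := by
  obtain ⟨m, hm⟩ := pow_unbounded_of_one_lt (C ^ (4 * D + 1)) (one_lt_two (α := ℝ))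
  have hm0 : 0 < m := by
    rcases Nat.eq_zero_or_pos m with rfl | h
    · have := one_le_pow₀ hC (n := 4 * D + 1)
      rw [pow_zero] at hm; linarith
    · exact h
  have hlim : ∀ᶠ T : ℕ in atTop,
      ((4 * c * (T : ℝ) ^ 4) * (14 * (T : ℝ)) ^ (4 * m)) ^ D * (2 / 3) ^ T < 1 := by
    have h := tendsto_pow_const_mul_const_pow_of_abs_lt_one ((4 + 4 * m) * D) (r := 2 / 3)
      (by rw [abs_of_pos] <;> norm_num)
    have h := h.const_mul ((4 * c * 14 ^ (4 * m)) ^ D)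
    rw [mul_zero] at h
    filter_upwards [h.eventually_lt_const one_pos] with T hT
    refine lt_of_eq_of_lt ?_ hT
    rw [pow_mul _ _ D, ← mul_assoc, ← mul_pow]
    congr 2
    rw [mul_pow]
    ring
  obtain ⟨T₀, hT₀⟩ := eventually_atTop.mp hlim
  refine ⟨m, T₀ + 1, hm0, by omega, fun T hT => ?_⟩
  set N := T₀ + 1 with hN
  have hNT : N ≤ T := (Nat.le_mul_of_pos_left N hm0).trans hT
  have hT1 : 1 ≤ T := by omega
  have hTr : (1 : ℝ) ≤ T := by exact_mod_cast hT1
  have h1 : C ^ (T * N) * (C ^ (4 * (T * N))) ^ D ≤ 2 ^ (T ^ 2) := by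
    calc _ = (C ^ (4 * D + 1)) ^ (T * N) := by rw [← pow_mul, ← pow_add, ← pow_mul]; congr 1; ring
      _ ≤ (2 ^ m) ^ (T * N) := by gcongr
      _ = 2 ^ (T * (m * N)) := by rw [← pow_mul]; congr 1; ring
      _ ≤ 2 ^ (T ^ 2) := by
        rw [pow_two]
        gcongr
        norm_num
  set Q : ℝ := (4 * c * (T : ℝ) ^ 4) * (14 * (T : ℝ)) ^ (4 * m) with hQ
  have h2 : c * (2 * (T : ℝ) ^ 2) ^ 2 * (14 * (T : ℝ)) ^ (2 * (2 * m ^ 2 * N)) ≤ Q ^ T := by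
    rw [hQ, mul_pow _ _ T, ← pow_mul]
    have h3 : c * (2 * (T : ℝ) ^ 2) ^ 2 = 4 * c * (T : ℝ) ^ 4 := by ring
    rw [h3]
    refine mul_le_mul ?_ (pow_le_pow_right₀ (by linarith) ?_) (by positivity) (by positivity)
    · apply le_self_pow₀ _ (by omega)
      have := one_le_pow₀ hTr (n := 4)
      nlinarith
    · calc 2 * (2 * m ^ 2 * N) = 4 * m * (m * N) := by ring
        _ ≤ 4 * m * T := by gcongr
  have h4 := hT₀ T (by omega)
  rw [← hQ] at h4
  have hQ0 : 0 < Q := by positivity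
  calc _ = (C ^ (T * N) * (C ^ (4 * (T * N))) ^ D) *
        (c * (2 * (T : ℝ) ^ 2) ^ 2 * (14 * (T : ℝ)) ^ (2 * (2 * m ^ 2 * N))) ^ D := by
        rw [mul_pow _ _ D]; ring
    _ ≤ 2 ^ (T ^ 2) * (Q ^ T) ^ D := by gcongr
    _ = 3 ^ (T ^ 2) * (Q ^ D * (2 / 3) ^ T) ^ T := by
        rw [mul_pow (Q ^ D) _ T, ← pow_mul Q, ← pow_mul Q, ← pow_mul (2 / 3 : ℝ), ← pow_two, mul_comm D T,
          div_pow]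
        field_simp
    _ < 3 ^ (T ^ 2) * 1 := by
        gcongr
        exact pow_lt_one₀ (by positivity) h4 (by omega)
    _ = _ := mul_one _

/-! ### The auxiliary function at Gaussian integers. -/

/-- The value of `z ^ j * α ^ (k * z)` at `z = a + b * i`, where `α = u / d` and `α ^ i = v / d`,
multiplied by the denominator `d ^ ((a + b) * N)`. -/
def gaussianValue {R : Type*} [CommRing R] (ι d u v : R) (N a b j k : ℕ) : R :=
  (a + b * ι) ^ j * u ^ (a * k) * v ^ (b * k) * d ^ ((a + b) * (N - k))

theorem map_gaussianValue {R S : Type*} [CommRing R] [CommRing S] (f : R →+* S) (ι d u v : R)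
    (N a b j k : ℕ) :
    f (gaussianValue ι d u v N a b j k) = gaussianValue (f ι) (f d) (f u) (f v) N a b j k := by
  simp [gaussianValue]

theorem gaussianValue_eq (d t : ℂ) {N k : ℕ} (hk : k ≤ N) (a b j : ℕ) :
    gaussianValue Complex.I d (d * Complex.exp t) (d * Complex.exp (t * Complex.I)) N a b j k =
      d ^ ((a + b) * N) *
        ((a + b * Complex.I) ^ j * Complex.exp (t * k * (a + b * Complex.I))) := by
  obtain ⟨e, rfl⟩ := Nat.exists_eq_add_of_le hk
  have : Complex.exp (t * k * (a + b * Complex.I)) =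
      Complex.exp t ^ (a * k) * Complex.exp (t * Complex.I) ^ (b * k) := by
    rw [← Complex.exp_nat_mul, ← Complex.exp_nat_mul, ← Complex.exp_add]
    push_cast
    ring_nf
  rw [this, gaussianValue, Nat.add_sub_cancel_left]
  ring

theorem norm_gaussianValue_le {ι d u v : ℂ} {C : ℝ} (hι : ‖ι‖ ≤ 1) (hd : ‖d‖ ≤ C) (hu : ‖u‖ ≤ C)
    (hv : ‖v‖ ≤ C) (hC : 1 ≤ C) {L N T a b j k : ℕ} (hT : 1 ≤ T) (ha : a ≤ T) (hb : b ≤ T)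
    (hj : j ≤ L) (hk : k ≤ N) :
    ‖gaussianValue ι d u v N a b j k‖ ≤ (2 * (T : ℝ)) ^ L * C ^ (2 * (T * N)) := by
  have hT' : (1 : ℝ) ≤ T := by exact_mod_cast hT
  have ha' : (a : ℝ) ≤ T := by exact_mod_cast ha
  have hb' : (b : ℝ) ≤ T := by exact_mod_cast hb
  have h1 : ‖(a : ℂ) + b * ι‖ ≤ 2 * T := by
    refine (norm_add_le _ _).trans ?_
    rw [norm_mul, Complex.norm_natCast, Complex.norm_natCast]
    have := mul_le_mul hb' hι (norm_nonneg _) (by positivity)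
    linarith
  have hC0 : 0 ≤ C := by linarith
  calc ‖gaussianValue ι d u v N a b j k‖
      ≤ (2 * (T : ℝ)) ^ j * C ^ (a * k) * C ^ (b * k) * C ^ ((a + b) * (N - k)) := by
        rw [gaussianValue, norm_mul, norm_mul, norm_mul, norm_pow, norm_pow, norm_pow, norm_pow]
        gcongr
    _ = (2 * (T : ℝ)) ^ j * C ^ ((a + b) * N) := by
        rw [mul_assoc, mul_assoc, ← pow_add, ← pow_add]
        obtain ⟨e, rfl⟩ := Nat.exists_eq_add_of_le hk
        rw [Nat.add_sub_cancel_left]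
        ring_nf
    _ ≤ _ := by
        refine mul_le_mul (pow_le_pow_right₀ (by linarith) hj) (pow_le_pow_right₀ hC ?_)
          (by positivity) (by positivity)
        calc (a + b) * N ≤ (T + T) * N := by gcongr
          _ = 2 * (T * N) := by ring

/-- The exponential polynomial with coefficients `c`. -/
noncomputable def expPoly {L N : ℕ} (t : ℝ) (c : Fin L × Fin N → ℂ) (z : ℂ) : ℂ :=
  ∑ l, c l * (z ^ (l.1 : ℕ) * Complex.exp (t * (l.2 : ℕ) * z))

theorem differentiable_expPoly {L N : ℕ} (t : ℝ) (c : Fin L × Fin N → ℂ) :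
    Differentiable ℂ (expPoly t c) := by
  unfold expPoly
  fun_prop

theorem norm_expPoly_le {L N : ℕ} {t : ℝ} (ht : 0 ≤ t) {c : Fin L × Fin N → ℂ} {B R : ℝ}
    (hc : ∀ l, ‖c l‖ ≤ B) (hR : 1 ≤ R) {z : ℂ} (hz : ‖z‖ ≤ R) :
    ‖expPoly t c z‖ ≤ (L * N : ℕ) * (B * (R ^ L * Real.exp (t * N * R))) := by
  refine (norm_sum_le _ _).trans ?_
  have : ((L * N : ℕ) : ℝ) * (B * (R ^ L * Real.exp (t * N * R))) =
      ∑ _l : Fin L × Fin N, B * (R ^ L * Real.exp (t * N * R)) := by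
    simp
  rw [this]
  refine Finset.sum_le_sum fun l _ => ?_
  have hB : 0 ≤ B := (norm_nonneg _).trans (hc l)
  rw [norm_mul, norm_mul, norm_pow, Complex.norm_exp]
  have h1 : ‖z‖ ^ (l.1 : ℕ) ≤ R ^ L :=
    (pow_le_pow_left₀ (norm_nonneg _) hz _).trans (pow_le_pow_right₀ hR l.1.2.le)
  have h2 : ((t : ℂ) * ((l.2 : ℕ) : ℂ) * z).re ≤ t * N * R := by
    have h3 : ((t : ℂ) * ((l.2 : ℕ) : ℂ) * z).re = t * (l.2 : ℕ) * z.re := by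
      rw [← Complex.ofReal_natCast, ← Complex.ofReal_mul, Complex.re_ofReal_mul]
    rw [h3]
    have h4 : z.re ≤ R := (Complex.re_le_norm z).trans hz
    have h5 : ((l.2 : ℕ) : ℝ) ≤ N := by exact_mod_cast l.2.2.le
    rcases le_total z.re 0 with h6 | h6
    · exact (mul_nonpos_of_nonneg_of_nonpos (by positivity) h6).trans (by positivity)
    · gcongr
  have h3 := Real.exp_le_exp.mpr h2
  gcongr
  exact hc l

/-- The Gaussian integers with both coordinates in `[0, T)`. -/
noncomputable def gaussianBox (T : ℕ) : Finset ℂ :=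
  (Finset.range T ×ˢ Finset.range T).image fun x => (x.1 : ℂ) + x.2 * Complex.I

theorem card_gaussianBox (T : ℕ) : (gaussianBox T).card = T ^ 2 := by
  rw [gaussianBox, Finset.card_image_of_injective, Finset.card_product, Finset.card_range, pow_two]
  rintro ⟨a, b⟩ ⟨a', b'⟩ h
  have h1 := congrArg Complex.re h
  have h2 := congrArg Complex.im h
  simp at h1 h2
  simp [h1, h2]

theorem norm_gaussian_le {T a b : ℕ} (ha : a ≤ T) (hb : b ≤ T) :
    ‖(a : ℂ) + b * Complex.I‖ ≤ 2 * T := by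
  have ha' : (a : ℝ) ≤ T := by exact_mod_cast ha
  have hb' : (b : ℝ) ≤ T := by exact_mod_cast hb
  refine (norm_add_le _ _).trans ?_
  rw [norm_mul, Complex.norm_natCast, Complex.norm_natCast, Complex.norm_I]
  linarith

theorem norm_expPoly_gaussian_le {L N : ℕ} {t : ℝ} (ht : 0 ≤ t) {c : Fin L × Fin N → ℂ} {B : ℝ}
    (hc : ∀ l, ‖c l‖ ≤ B) {T : ℕ} (hT : 1 ≤ T)
    (h : ∀ a < T, ∀ b < T, expPoly t c (a + b * Complex.I) = 0) {a b : ℕ} (ha : a ≤ T)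
    (hb : b ≤ T) :
    ‖expPoly t c (a + b * Complex.I)‖ ≤
      (L * N : ℕ) * (B * ((14 * (T : ℝ)) ^ L * Real.exp (14 * t) ^ (T * N))) / 3 ^ T ^ 2 := by
  have hT' : (1 : ℝ) ≤ T := by exact_mod_cast hT
  have key := (differentiable_expPoly t c).norm_le_mul_pow_card_of_zeros (gaussianBox T)
    (r := 2 * T) (R := 14 * T) (w := a + b * Complex.I)
    (by
      intro ζ hζ
      simp only [gaussianBox, Finset.mem_image, Finset.mem_product, Finset.mem_range] at hζ
      obtain ⟨x, hx, rfl⟩ := hζ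
      exact h _ hx.1 _ hx.2)
    (by
      intro ζ hζ
      simp only [gaussianBox, Finset.mem_image, Finset.mem_product, Finset.mem_range] at hζ
      obtain ⟨x, hx, rfl⟩ := hζ
      exact norm_gaussian_le hx.1.le hx.2.le)
    (by positivity) (by linarith)
    (fun z hz => norm_expPoly_le ht hc (by linarith) hz.le) (norm_gaussian_le ha hb)
  refine key.trans (le_of_eq ?_)
  -- The radius `14 * T` is chosen so that each of the `T ^ 2` zeros saves a factor `3`.
  have h1 : 2 * (2 * (T : ℝ)) / (14 * T - 2 * T) = 1 / 3 := by
    rw [div_eq_div_iff (by linarith) (by norm_num)]; ring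
  rw [card_gaussianBox, h1, ← Real.exp_nat_mul, div_pow, one_pow, mul_one_div]
  push_cast
  ring_nf

/-! ### Schneider's method and Gelfond–Schneider. -/

/-- Schneider's method: a number field cannot contain `i`, `exp t` and `exp (i * t)` for real
`t > 0`. -/
theorem false_of_exp_mem_numberField {K : Type*} [Field K] [NumberField K] (σ : K →+* ℂ)
    (ι d u v : 𝓞 K) {t : ℝ} (ht : 0 < t) (hι : σ ι = Complex.I) (hd : d ≠ 0)
    (hu : σ u = σ d * Complex.exp t) (hv : σ v = σ d * Complex.exp (t * Complex.I)) : False := by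
  obtain ⟨c, hc, siegel⟩ := exists_int_vec_house_le K
  set D := Module.finrank ℚ K with hD
  have hD0 : 0 < D := Module.finrank_pos
  obtain ⟨C, hC, hCd, hCu, hCv, hCt⟩ : ∃ C : ℝ, 1 ≤ C ∧ house (d : K) ≤ C ∧ house (u : K) ≤ C ∧
      house (v : K) ≤ C ∧ Real.exp (14 * t) ≤ C := by
    have h1 := house_nonneg (d : K)
    have h2 := house_nonneg (u : K)
    have h3 := house_nonneg (v : K)
    have h4 := Real.exp_pos (14 * t)
    exact ⟨1 + house (d : K) + house (u : K) + house (v : K) + Real.exp (14 * t),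
      by linarith, by linarith, by linarith, by linarith, by linarith⟩
  obtain ⟨m, N, hm, hN, hpar⟩ := exists_schneider_parameters c C hc hC D
  have hσ0 : ∀ x : 𝓞 K, σ x = 0 → x = 0 := fun x hx => by
    have := (map_eq_zero σ).mp hx
    exact_mod_cast this
  have hι2 : ∀ τ : K →+* ℂ, ‖τ ι‖ ≤ 1 := by
    intro τ
    have h1 : (ι : K) ^ 2 = -1 := by
      apply σ.injective
      rw [map_pow, hι]; simp
    have h2 : ‖τ ι‖ ^ 2 = 1 := by
      rw [← norm_pow, ← map_pow, h1]; simp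
    nlinarith [norm_nonneg (τ ι)]
  set S := m * N with hS
  have hS0 : 0 < S := Nat.mul_pos hm hN
  set L := 2 * m ^ 2 * N with hL
  have hLN : L * N = 2 * S ^ 2 := by rw [hL, hS]; ring
  have hL0 : 0 < L := by positivity
  have hmap : ∀ (τ : K →+* ℂ) (a b j k : ℕ), τ (gaussianValue ι d u v N a b j k : 𝓞 K) =
      gaussianValue (τ ι) (τ d) (τ u) (τ v) N a b j k := fun τ a b j k =>
    map_gaussianValue (τ.comp (algebraMap (𝓞 K) K)) ι d u v N a b j k
  have hentry : ∀ {T a b : ℕ} (l : Fin L × Fin N), 1 ≤ T → a ≤ T → b ≤ T →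
      house ((gaussianValue ι d u v N a b l.1 l.2 : 𝓞 K) : K) ≤
        (2 * (T : ℝ)) ^ L * C ^ (2 * (T * N)) := by
    intro T a b l hT ha hb
    refine house_le_of_forall (by positivity) fun τ => ?_
    rw [hmap]
    exact norm_gaussianValue_le (hι2 τ) ((norm_embedding_le_house _ τ).trans hCd)
      ((norm_embedding_le_house _ τ).trans hCu) ((norm_embedding_le_house _ τ).trans hCv) hC
      hT ha hb l.1.2.le l.2.2.le
  obtain ⟨ξ, hξ0, hξ, hξB⟩ := siegel
    (fun (x : Fin S × Fin S) (l : Fin L × Fin N) => gaussianValue ι d u v N x.1 x.2 l.1 l.2)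
    ((2 * (S : ℝ)) ^ L * C ^ (2 * (S * N))) (S ^ 2) (by positivity) (by simp [pow_two])
    (by simp [hLN])
    (by
      -- The matrix is nonzero: its entry at `a = b = j = k = 0` is `1`.
      intro h
      have h1 := congrFun (congrFun h (⟨0, hS0⟩, ⟨0, hS0⟩)) (⟨0, hL0⟩, ⟨0, hN⟩)
      simp [gaussianValue] at h1)
    (fun x l => hentry l hS0 x.1.2.le x.2.2.le)
  set B := c * (2 * ((S ^ 2 : ℕ) : ℝ)) * ((2 * (S : ℝ)) ^ L * C ^ (2 * (S * N))) with hB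
  -- The integral form of `F(a + bi)`, scaled by `d ^ ((a + b) * N)`.
  set w : ℕ → ℕ → 𝓞 K := fun a b => ∑ l : Fin L × Fin N, gaussianValue ι d u v N a b l.1 l.2 * ξ l
    with hw
  have hσw : ∀ a b, σ (w a b) =
      σ d ^ ((a + b) * N) * expPoly t (fun l => σ (ξ l)) (a + b * Complex.I) := by
    intro a b
    rw [hw, expPoly, Finset.mul_sum]
    simp only [map_sum, map_mul]
    refine Finset.sum_congr rfl fun l _ => ?_
    rw [hmap, hι, hu, hv,
      gaussianValue_eq _ _ l.2.2.le]
    ring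
  have hvanish : ∀ a b, w a b = 0 ↔ expPoly t (fun l => σ (ξ l)) (a + b * Complex.I) = 0 := by
    intro a b
    have hd' : σ d ^ ((a + b) * N) ≠ 0 := pow_ne_zero _ fun h => hd (hσ0 d h)
    constructor
    · intro h
      have := hσw a b
      rw [h] at this
      simpa [hd', eq_comm] using this
    · intro h
      apply hσ0
      rw [hσw, h, mul_zero]
  have hstep : ∀ T, S ≤ T → ∀ a < T, ∀ b < T, w a b = 0 := by
    intro T hT
    induction T, hT using Nat.le_induction with
    | base =>
      intro a ha b hb
      exact congrFun hξ (⟨a, ha⟩, ⟨b, hb⟩)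
    | succ T hT ih =>
      intro a ha b hb
      have ha := Nat.lt_succ_iff.mp ha
      have hb := Nat.lt_succ_iff.mp hb
      by_contra hne
      have hT1 : 1 ≤ T := hS0.trans_le hT
      have hTr : (1 : ℝ) ≤ T := by exact_mod_cast hT1
      have hST : (S : ℝ) ≤ T := by exact_mod_cast hT
      have hone := one_le_norm_mul_house_pow σ hne
      have hB0 : 0 ≤ B := by positivity
      have hLNT : ((L * N : ℕ) : ℝ) ≤ 2 * (T : ℝ) ^ 2 := by
        rw [hLN]; push_cast; gcongr
      have hBT : B ≤ c * (2 * (T : ℝ) ^ 2) * ((2 * (T : ℝ)) ^ L * C ^ (2 * (T * N))) := by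
        rw [hB]; push_cast; gcongr
      set H : ℝ := c * (2 * (T : ℝ) ^ 2) ^ 2 * (14 * (T : ℝ)) ^ (2 * L) * C ^ (4 * (T * N)) with hH
      have hH0 : 0 ≤ H := by positivity
      have h14 : 2 * (T : ℝ) ≤ 14 * T := by linarith
      have hhouse : house (w a b : K) ≤ H := by
        calc house (w a b : K)
            ≤ ∑ l : Fin L × Fin N,
              house ((gaussianValue ι d u v N a b l.1 l.2 : 𝓞 K) * (ξ l : 𝓞 K) : K) := by
              simp only [hw, map_sum, map_mul]
              exact house_sum_le_sum_house _ _
          _ ≤ ∑ _l : Fin L × Fin N, (2 * (T : ℝ)) ^ L * C ^ (2 * (T * N)) * B := by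
              refine Finset.sum_le_sum fun l _ => (house_mul_le _ _).trans ?_
              exact mul_le_mul (hentry l hT1 ha hb) (hξB l) (house_nonneg _) (by positivity)
          _ = (L * N : ℕ) * ((2 * (T : ℝ)) ^ L * C ^ (2 * (T * N)) * B) := by simp
          _ ≤ 2 * (T : ℝ) ^ 2 * ((14 * (T : ℝ)) ^ L * C ^ (2 * (T * N)) *
              (c * (2 * (T : ℝ) ^ 2) * ((14 * (T : ℝ)) ^ L * C ^ (2 * (T * N))))) := by
              gcongr
              exact hBT.trans (by gcongr)
          _ = H := by rw [hH]; ring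
      have hsmall : ‖σ (w a b)‖ ≤ C ^ (T * N) * H / 3 ^ T ^ 2 := by
        have hF := norm_expPoly_gaussian_le ht.le (c := fun l => σ (ξ l)) (B := B)
          (fun l => (norm_embedding_le_house _ σ).trans (hξB l)) hT1
          (fun a ha b hb => (hvanish a b).mp (ih a ha b hb)) ha hb
        have hdC : ‖σ d‖ ^ ((a + b) * N) ≤ C ^ (2 * (T * N)) := by
          refine (pow_le_pow_left₀ (norm_nonneg _)
            ((norm_embedding_le_house _ σ).trans hCd) _).trans (pow_le_pow_right₀ hC ?_)
          calc (a + b) * N ≤ (T + T) * N := by gcongr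
            _ = 2 * (T * N) := by ring
        calc ‖σ (w a b)‖ = ‖σ d‖ ^ ((a + b) * N) *
              ‖expPoly t (fun l => σ (ξ l)) (a + b * Complex.I)‖ := by
              rw [hσw, norm_mul, norm_pow]
          _ ≤ C ^ (2 * (T * N)) * ((2 * (T : ℝ) ^ 2) *
              ((c * (2 * (T : ℝ) ^ 2) * ((14 * (T : ℝ)) ^ L * C ^ (2 * (T * N)))) *
              ((14 * (T : ℝ)) ^ L * C ^ (T * N))) / 3 ^ T ^ 2) := by
              refine mul_le_mul hdC (hF.trans ?_) (norm_nonneg _) (by positivity)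
              gcongr
              exact hBT.trans (by gcongr)
          _ = _ := by rw [hH]; ring
      have hfin := hpar T hT
      rw [← hH] at hfin
      -- One small conjugate and `D - 1` bounded by `H` contradict `hone`.
      have : ‖σ (w a b)‖ * house (w a b : K) ^ (D - 1) < 1 := by
        calc _ ≤ C ^ (T * N) * H / 3 ^ T ^ 2 * H ^ (D - 1) := by
              have := house_nonneg (w a b : K)
              gcongr
          _ = C ^ (T * N) * H ^ D / 3 ^ T ^ 2 := by
              obtain ⟨e, he⟩ := Nat.exists_eq_add_of_lt hD0
              rw [he, zero_add, Nat.add_sub_cancel, pow_succ]; ring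
          _ < 1 := by rw [div_lt_one (by positivity)]; exact hfin
      linarith
  have hzero := coeff_eq_zero_of_sum_mul_pow_mul_exp_eq_zero ht (fun l => σ (ξ l)) (by
    intro n
    -- Only the zeros on the real axis are needed; the box of side `S + n + 1` contains `n`.
    have h1 := (hvanish n 0).mp (hstep (S + n + 1) (by omega) n (by omega) 0 (by omega))
    simpa [expPoly, mul_assoc] using h1)
  exact hξ0 (funext fun l => hσ0 _ (congrFun hzero l))

theorem exp_mul_I_transcendental_of_pos {t : ℝ} (ht : 0 < t) (h1 : IsAlgebraic ℚ (Complex.exp t))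
    (h2 : IsAlgebraic ℚ (Complex.exp (t * Complex.I))) : False := by
  have h0 : IsAlgebraic ℚ Complex.I :=
    ⟨Polynomial.X ^ 2 + 1, (Polynomial.monic_X_pow_add_C (1 : ℚ) two_ne_zero).ne_zero, by simp⟩
  set s : Set ℂ := {Complex.I, Complex.exp t, Complex.exp (t * Complex.I)} with hs
  have hfd : FiniteDimensional ℚ (IntermediateField.adjoin ℚ s) := by
    refine IntermediateField.finiteDimensional_adjoin fun x hx => ?_
    simp only [hs, Set.mem_insert_iff, Set.mem_singleton_iff] at hx
    rcases hx with rfl | rfl | rfl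
    exacts [h0.isIntegral, h1.isIntegral, h2.isIntegral]
  set K := IntermediateField.adjoin ℚ s
  have : NumberField K := { to_finiteDimensional := hfd }
  have hmem : ∀ x ∈ s, x ∈ K := fun x hx => IntermediateField.subset_adjoin ℚ s hx
  let ι : K := ⟨Complex.I, hmem _ (by simp [hs])⟩
  let α : K := ⟨Complex.exp t, hmem _ (by simp [hs])⟩
  let β : K := ⟨Complex.exp (t * Complex.I), hmem _ (by simp [hs])⟩
  have hι : IsIntegral ℤ ι := by
    refine ⟨Polynomial.X ^ 2 + 1, Polynomial.monic_X_pow_add_C (1 : ℤ) two_ne_zero, ?_⟩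
    simp only [Polynomial.eval₂_add, Polynomial.eval₂_pow, Polynomial.eval₂_X,
      Polynomial.eval₂_one]
    apply Subtype.ext
    simp [ι]
  have halg : ∀ x : K, IsAlgebraic ℤ x := fun x =>
    (IsFractionRing.isAlgebraic_iff ℤ ℚ K).mpr (Algebra.IsAlgebraic.isAlgebraic x)
  obtain ⟨d₁, hd₁, hα⟩ := (halg α).exists_integral_multiple
  obtain ⟨d₂, hd₂, hβ⟩ := (halg β).exists_integral_multiple
  -- A common denominator is needed, since `d` must serve both exponentials.
  have hα' : IsIntegral ℤ ((d₁ * d₂) • α) := by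
    rw [mul_comm, mul_smul]; exact hα.smul d₂
  have hβ' : IsIntegral ℤ ((d₁ * d₂) • β) := by
    rw [mul_smul]; exact hβ.smul d₁
  refine false_of_exp_mem_numberField (K := K) (algebraMap K ℂ) ⟨ι, hι⟩ ((d₁ * d₂ : ℤ) : 𝓞 K)
    ⟨_, hα'⟩ ⟨_, hβ'⟩ ht rfl (by exact_mod_cast mul_ne_zero hd₁ hd₂) ?_ ?_
  · simp [α, IntermediateField.algebraMap_apply]
  · simp [β, IntermediateField.algebraMap_apply]

/-- The Gelfond–Schneider theorem for the exponent `i` and a positive real base. -/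
theorem eq_zero_of_isAlgebraic_exp {t : ℝ} (h1 : IsAlgebraic ℚ (Complex.exp t))
    (h2 : IsAlgebraic ℚ (Complex.exp (t * Complex.I))) : t = 0 := by
  rcases lt_trichotomy t 0 with ht | ht | ht
  · refine (exp_mul_I_transcendental_of_pos (t := -t) (by linarith) ?_ ?_).elim
    · rw [Complex.ofReal_neg, Complex.exp_neg]; exact h1.inv
    · rw [Complex.ofReal_neg, neg_mul, Complex.exp_neg]; exact h2.inv
  · exact ht
  · exact (exp_mul_I_transcendental_of_pos ht h1 h2).elim

/-! ### From the equation to Gelfond–Schneider. -/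

/-- `e^{it}` is a root of `X² - 2sX + 1`. -/
theorem isAlgebraic_exp_mul_I_of_cos {t : ℝ} {s : ℚ} (h : Real.cos t = s) :
    IsAlgebraic ℚ (Complex.exp (t * Complex.I)) := by
  refine ⟨Polynomial.X ^ 2 + (Polynomial.C (-(2 * s)) * Polynomial.X + Polynomial.C 1), ?_, ?_⟩
  · refine (Polynomial.monic_X_pow_add ?_).ne_zero
    exact (Polynomial.degree_linear_le).trans_lt (by norm_num)
  · have h1 : Complex.cos t = s := by rw [← Complex.ofReal_cos, h]; simp
    have h2 := Complex.sin_sq_add_cos_sq t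
    rw [Complex.exp_mul_I]
    simp only [map_add, map_pow, Polynomial.aeval_X, map_mul, Polynomial.aeval_C, map_neg,
      map_one]
    simp only [eq_ratCast]
    push_cast
    rw [← h1]
    linear_combination -h2 + Complex.sin t ^ 2 * Complex.I_sq

theorem natCast_cpow_two_add_I_mul {x : ℕ} (hx : 0 < x) (p : ℤ) :
    (x : ℂ) ^ (2 + Complex.I * (p : ℂ)) =
      (x : ℂ) ^ 2 * Complex.exp ((p * Real.log x : ℝ) * Complex.I) := by
  have hx0 : (x : ℂ) ≠ 0 := by exact_mod_cast hx.ne'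
  rw [Complex.cpow_add _ _ hx0, Complex.cpow_ofNat, Complex.cpow_def_of_ne_zero hx0,
    ← Complex.natCast_log]
  push_cast
  ring_nf

/-- The law of cosines for a triangle relation in the complex plane. -/
theorem cos_sub_eq_of_triangle {a b c A B G : ℝ} (ha : a ≠ 0) (hb : b ≠ 0)
    (h : a * Complex.exp (A * Complex.I) + b * Complex.exp (B * Complex.I) =
      c * Complex.exp (G * Complex.I)) :
    Real.cos (A - B) = (c ^ 2 - a ^ 2 - b ^ 2) / (2 * a * b) := by
  have hre := congrArg Complex.re h
  have him := congrArg Complex.im h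
  simp only [Complex.add_re, Complex.add_im, Complex.re_ofReal_mul, Complex.im_ofReal_mul,
    Complex.exp_ofReal_mul_I_re, Complex.exp_ofReal_mul_I_im] at hre him
  rw [eq_div_iff (by positivity), Real.cos_sub]
  have e1 : c ^ 2 = (c * Real.cos G) ^ 2 + (c * Real.sin G) ^ 2 := by
    linear_combination -c ^ 2 * Real.sin_sq_add_cos_sq G
  rw [e1, ← hre, ← him]
  linear_combination -a ^ 2 * Real.sin_sq_add_cos_sq A - b ^ 2 * Real.sin_sq_add_cos_sq B

theorem isAlgebraic_exp_log_sub (x y : ℕ) (hx : 0 < x) (hy : 0 < y) (p q : ℤ) :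
    IsAlgebraic ℚ (Complex.exp ((p * Real.log x - q * Real.log y : ℝ) : ℂ)) := by
  have : Complex.exp ((p * Real.log x - q * Real.log y : ℝ) : ℂ) =
      algebraMap ℚ ℂ ((x : ℚ) ^ p / (y : ℚ) ^ q) := by
    have hx' : (0 : ℝ) < x := by exact_mod_cast hx
    have hy' : (0 : ℝ) < y := by exact_mod_cast hy
    rw [← Complex.ofReal_exp, Real.exp_sub, ← Real.log_zpow, ← Real.log_zpow,
      Real.exp_log (by positivity), Real.exp_log (by positivity)]
    simp
  rw [this]
  exact isAlgebraic_algebraMap _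

/-- Logarithms of positive integers are nonnegative, so absolute values remove the signs of `p` and
`q`. -/
theorem natAbs_pow_eq_of_mul_log_eq {x y : ℕ} (hx : 0 < x) (hy : 0 < y) {p q : ℤ}
    (h : p * Real.log x = q * Real.log y) : x ^ p.natAbs = y ^ q.natAbs := by
  have h1 := congrArg abs h
  have hx' : (0 : ℝ) < x := by exact_mod_cast hx
  have hy' : (0 : ℝ) < y := by exact_mod_cast hy
  rw [abs_mul, abs_mul, abs_of_nonneg (Real.log_natCast_nonneg x),
    abs_of_nonneg (Real.log_natCast_nonneg y), ← Int.cast_abs, ← Int.cast_abs,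
    ← Nat.cast_natAbs, ← Nat.cast_natAbs, ← Real.log_pow, ← Real.log_pow] at h1
  have h2 := Real.log_injOn_pos (Set.mem_Ioi.mpr (by positivity)) (Set.mem_Ioi.mpr (by positivity))
    h1
  exact_mod_cast h2

/-- A prime dividing `x` divides `y` and then `z`; if `x = 1` then `y = 1` and `z² = 2`. -/
theorem not_pythagorean_of_pow_eq {x y z m n : ℕ} (hm : m ≠ 0) (hn : n ≠ 0)
    (hpow : x ^ m = y ^ n) (hz : x ^ 2 + y ^ 2 = z ^ 2)
    (hgcd : Nat.gcd (Nat.gcd x y) z = 1) : False := by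
  by_cases hx : x = 1
  · subst hx
    rw [one_pow, eq_comm, Nat.pow_eq_one] at hpow
    obtain rfl : y = 1 := hpow.resolve_right hn
    have : z < 2 := by nlinarith
    interval_cases z <;> omega
  · obtain ⟨l, hl, hlx⟩ := Nat.exists_prime_and_dvd hx
    have hly : l ∣ y := hl.dvd_of_dvd_pow (hpow ▸ dvd_pow hlx hm)
    have hlz : l ∣ z := hl.dvd_of_dvd_pow
      (hz ▸ dvd_add (dvd_pow hlx two_ne_zero) (dvd_pow hly two_ne_zero))
    have := Nat.dvd_gcd (Nat.dvd_gcd hlx hly) hlz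
    rw [hgcd] at this
    exact hl.one_lt.ne' (Nat.dvd_one.mp this)

theorem proposition3p6 (p q r : ℤ) (hpq : p * q ≠ 0) :
    ¬ ∃ x y z : ℤ, 0 < x ∧ 0 < y ∧ 0 < z ∧ Int.gcd (Int.gcd x y) z = 1 ∧
      (x : ℂ) ^ (2 + Complex.I * (p : ℂ)) + (y : ℂ) ^ (2 + Complex.I * (q : ℂ)) =
        (z : ℂ) ^ (2 + Complex.I * (r : ℂ)) := by
  rintro ⟨x, y, z, hx, hy, hz, hgcd, h⟩
  lift x to ℕ using hx.le
  lift y to ℕ using hy.le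
  lift z to ℕ using hz.le
  norm_cast at hx hy hz
  have hx' : (x : ℝ) ≠ 0 := by exact_mod_cast hx.ne'
  have hy' : (y : ℝ) ≠ 0 := by exact_mod_cast hy.ne'
  simp only [Int.cast_natCast] at h
  rw [natCast_cpow_two_add_I_mul hx, natCast_cpow_two_add_I_mul hy,
    natCast_cpow_two_add_I_mul hz] at h
  have htri : ((x ^ 2 : ℝ) : ℂ) * Complex.exp ((p * Real.log x : ℝ) * Complex.I) +
      ((y ^ 2 : ℝ) : ℂ) * Complex.exp ((q * Real.log y : ℝ) * Complex.I) =
      ((z ^ 2 : ℝ) : ℂ) * Complex.exp ((r * Real.log z : ℝ) * Complex.I) := by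
    simpa only [Complex.ofReal_pow, Complex.ofReal_natCast] using h
  have hcos := cos_sub_eq_of_triangle (pow_ne_zero 2 hx') (pow_ne_zero 2 hy') htri
  have hzero : p * Real.log x - q * Real.log y = 0 := by
    refine eq_zero_of_isAlgebraic_exp (isAlgebraic_exp_log_sub x y hx hy p q)
      (isAlgebraic_exp_mul_I_of_cos
        (s := (((z : ℚ) ^ 2) ^ 2 - ((x : ℚ) ^ 2) ^ 2 - ((y : ℚ) ^ 2) ^ 2) /
          (2 * (x : ℚ) ^ 2 * (y : ℚ) ^ 2)) ?_)
    rw [hcos]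
    push_cast
    rfl
  -- Cosine `1` reads `z⁴ - x⁴ - y⁴ = 2x²y²`, that is `(x² + y²)² = z⁴`.
  rw [hzero, Real.cos_zero, eq_comm, div_eq_one_iff_eq (by positivity)] at hcos
  have hsq : x ^ 2 + y ^ 2 = z ^ 2 := by
    have h1 : ((x : ℝ) ^ 2 + (y : ℝ) ^ 2) ^ 2 = ((z : ℝ) ^ 2) ^ 2 := by linear_combination -hcos
    have h2 : (x ^ 2 + y ^ 2) ^ 2 = (z ^ 2) ^ 2 := by exact_mod_cast h1
    exact Nat.pow_left_injective two_ne_zero h2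
  refine not_pythagorean_of_pow_eq (Int.natAbs_ne_zero.mpr (left_ne_zero_of_mul hpq))
    (Int.natAbs_ne_zero.mpr (right_ne_zero_of_mul hpq))
    (natAbs_pow_eq_of_mul_log_eq hx hy (sub_eq_zero.mp hzero)) hsq ?_
  simpa [Int.gcd_natCast_natCast] using hgcd
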